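/- Consider $N$ nodes at distinct points $\mathbf{x}(1),\dots,\mathbf{x}(N)$ of the Euclidean plane, and let $R$ be the communication range. Around node $n$ the directions of the plane are divided by sectoring axes into $K_n$ consecutive sectors $\sigma_n^1,\dots,\sigma_n^{K_n}$ with positive fields of view that sum to $360^\circ$ (each sector contains the axis at which it begins and not the one at which it ends). The set $\mathcal{L}^\sigma$ of directed links of the sectorized network $G^\sigma$ consists of all $(\sigma_n^k,\sigma_{n'}^{k'})$ with $n\neq n'$ such that $|\mathbf{x}(n)-\mathbf{x}(n')|\le 2R$, node $n'$ lies in the field of view of $\sigma_n^k$, and node $n$ lies in the field of view of $\sigma_{n'}^{k'}$. Under the primary interference constraints, the set $\mathcal{X}_{G^\sigma}\subseteq\{0,1\}^{\mathcal{L}^\sigma}$ of feasible schedules consists of the $0$-$1$ vectors for which, in each node sector, at most one outgoing or incoming link is scheduled. The auxiliary graph $H^\sigma=(V^\sigma,E^\sigma)$ has one vertex $n_k$ for every sector $\sigma_n^k$ and one directed edge from $n_k$ to $n'_{k'}$ for every link $(\sigma_n^k,\sigma_{n'}^{k'})\in\mathcal{L}^\sigma$; in this way $E^\sigma$ and $\mathcal{L}^\sigma$,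 and hence the vectors indexed by them, are identified. Let $\mathcal{M}_{H^\sigma}\subseteq\{0,1\}^{E^\sigma}$ be the set of indicator vectors of matchings of $H^\sigma$ (sets of edges no two of which share a vertex), and let $\mathcal{P}_{H^\sigma}$ be the matching polytope of $H^\sigma$, that is, the set of all $x\in\mathbb{R}^{E^\sigma}$ with $$x_e\ge 0\ \ \forall e\in E^\sigma,\qquad \sum_{e\in\delta(v)}x_e\le 1\ \ \forall v\in V^\sigma,\qquad \sum_{e\in E(U)}x_e\le\lfloor |U|/2\rfloor\ \ \forall U\subseteq V^\sigma\text{ with } |U|\text{ odd},$$ where $\delta(v)$ is the set of edges entering or leaving $v$ and $E(U)$ is the set of edges with both endpoints in $U$. Then $$\mathcal{X}_{G^\sigma}=\mathcal{M}_{H^\sigma}\qquad\text{and}\qquad \mathrm{Co}(\mathcal{X}_{G^\sigma})=\mathrm{Co}(\mathcal{M}_{H^\sigma})=\mathcal{P}_{H^\sigma},$$ where $\mathrm{Co}$ denotes the convex hull. -/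

import Mathlib

open scoped Finset

noncomputable section

namespace SectorNet

/-- The azimuth plane, with the Euclidean norm. -/
abbrev Plane : Type := EuclideanSpace ℝ (Fin 2)

/-- A sectorization of one node into `K` sectors: sector `0` starts at the sectoring axis of
angle `axis`, the sectors follow each other counterclockwise, sector `k` has a field of view of
angle `fov k`, and together they cover the full turn. -/
structure Sectorization (K : ℕ) where
  axis : ℝ
  fov : Fin K → ℝ
  fov_pos : ∀ k, 0 < fov k
  fov_sum : ∑ k, fov k = 2 * Real.pi

namespace Sectorization

variable {K : ℕ}

/-- The angle of the sectoring axis at which sector `k` begins. -/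
def start (s : Sectorization K) (k : Fin K) : ℝ :=
  s.axis + ∑ j ∈ Finset.Iio k, s.fov j

/-- The displacement `d` from the node points into the field of view of sector `k`. A field of
view contains the sectoring axis at which it begins and not the one at which it ends, so that
every nonzero displacement points into exactly one sector. -/
def Sees (s : Sectorization K) (k : Fin K) (d : Plane) : Prop :=
  ∃ r : ℝ, 0 < r ∧ ∃ φ ∈ Set.Ico (s.start k) (s.start k + s.fov k),
    d = !₂[r * Real.cos φ, r * Real.sin φ]

end Sectorization

/-- A network of `N` nodes at distinct places of the plane, with communication range `range`,
where node `n` is sectorized into `K n` sectors. -/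
structure SectorizedNetwork (N : ℕ) (K : Fin N → ℕ) where
  loc : Fin N → Plane
  loc_injective : Function.Injective loc
  range : ℝ
  sectorization : ∀ n, Sectorization (K n)

namespace SectorizedNetwork

variable {N : ℕ} {K : Fin N → ℕ} (G : SectorizedNetwork N K)

/-- Feasibility of the directed link from sector `k` of node `n` to sector `k'` of node `n'`:
the nodes are distinct and within twice the range of each other, and each node lies in the field
of view of the given sector of the other one. -/
def IsFeasibleLink (n : Fin N) (k : Fin (K n)) (n' : Fin N) (k' : Fin (K n')) : Prop :=
  n ≠ n' ∧
    ‖G.loc n - G.loc n'‖ ≤ 2 * G.range ∧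
    (G.sectorization n').Sees k' (G.loc n - G.loc n') ∧
    (G.sectorization n).Sees k (G.loc n' - G.loc n)

/-- The directed links of the connectivity graph, represented by node sectors. -/
@[ext]
structure Link where
  txNode : Fin N
  txSector : Fin (K txNode)
  rxNode : Fin N
  rxSector : Fin (K rxNode)
  feasible : G.IsFeasibleLink txNode txSector rxNode rxSector

variable {G} in
/-- The link `l` goes out of, or comes into, sector `k` of node `n`. -/
def Link.Uses (l : G.Link) (n : Fin N) (k : Fin (K n)) : Prop :=
  (⟨l.txNode, l.txSector⟩ : Σ m, Fin (K m)) = ⟨n, k⟩ ∨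
    (⟨l.rxNode, l.rxSector⟩ : Σ m, Fin (K m)) = ⟨n, k⟩

/-- The feasible schedules under the primary interference constraints: the `0`-`1` vectors
indexed by the links such that in each node sector at most one outgoing or incoming link is
scheduled. -/
def feasibleSchedules : Set (G.Link → ℝ) :=
  {X | (∀ l, X l = 0 ∨ X l = 1) ∧
    ∀ (n : Fin N) (k : Fin (K n)), {l : G.Link | X l = 1 ∧ l.Uses n k}.Subsingleton}

/-- The vertices of the auxiliary graph: every node is split into one vertex per sector. -/
abbrev AuxVertex (K : Fin N → ℕ) : Type := Σ n : Fin N, Fin (K n)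

/-- The auxiliary graph: every feasible link is inherited as a directed edge between the vertices
of its sectors. -/
def auxGraph : Digraph (AuxVertex K) where
  Adj v w := G.IsFeasibleLink v.1 v.2 w.1 w.2

end SectorizedNetwork

section Matching

variable {V : Type*} (H : Digraph V)

/-- The directed edges of `H`; opposite edges between the same two vertices are distinct. -/
abbrev Edge : Type _ := {e : V × V // H.Adj e.1 e.2}

variable {H} in
/-- The edge `e` is incident to the vertex `v`. -/
def Edge.Incident (e : Edge H) (v : V) : Prop := e.1.1 = v ∨ e.1.2 = v

/-- A set of edges is a matching if no two of its edges share a vertex. -/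
def IsMatching (M : Set (Edge H)) : Prop :=
  ∀ e ∈ M, ∀ e' ∈ M, e ≠ e' → ∀ v, ¬ (e.Incident v ∧ e'.Incident v)

/-- The set of matchings of `H`, as `0`-`1` vectors indexed by the edges. -/
def matchings : Set (Edge H → ℝ) :=
  {x | ∃ M : Set (Edge H), IsMatching H M ∧ x = M.indicator 1}

open Classical in
/-- The matching polytope of `H`, given by nonnegativity, the degree constraints, and the
odd-set constraints. -/
def matchingPolytope [Fintype V] : Set (Edge H → ℝ) :=
  {x | (∀ e, 0 ≤ x e) ∧
    (∀ v : V, ∑ e : Edge H with e.Incident v, x e ≤ 1) ∧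
    ∀ U : Finset V, Odd #U →
      ∑ e : Edge H with e.1.1 ∈ U ∧ e.1.2 ∈ U, x e ≤ ((#U / 2 : ℕ) : ℝ)}

end Matching

namespace SectorizedNetwork

variable {N : ℕ} {K : Fin N → ℕ} (G : SectorizedNetwork N K)

/-- The canonical bijection from the edges of the auxiliary graph to the links of the network. -/
def edgeEquivLink : Edge G.auxGraph ≃ G.Link where
  toFun e := ⟨e.1.1.1, e.1.1.2, e.1.2.1, e.1.2.2, e.2⟩
  invFun l := ⟨(⟨l.txNode, l.txSector⟩, ⟨l.rxNode, l.rxSector⟩), l.feasible⟩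
  left_inv _ := rfl
  right_inv _ := rfl

/-- Reindexing along the canonical bijection: the entry of a vector at a link becomes the entry
at the corresponding edge of the auxiliary graph. -/
def toAux : (G.Link → ℝ) ≃ₗ[ℝ] (Edge G.auxGraph → ℝ) :=
  LinearEquiv.funCongrLeft ℝ ℝ G.edgeEquivLink

end SectorizedNetwork

end SectorNet

end

namespace SectorNet

/-! Schedules and matchings are the same 0-1 vectors up to reindexing, so the substance is Edmonds'
matching polytope theorem for a loopless graph in which opposite edges are parallel. By Hahn–Banach
it is enough that no linear weight is larger on the polytope than at its best matching.

For nonnegative, nonzero weights, some degree or odd-set constraint is tight at all maximum weight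
matchings (`exists_tight_constraint`). If no vertex lies in all of them, a Gallai-type exchange
argument shows that none misses two vertices of a component of the positive-weight edges, and that
component is the odd set.

Subtracting a multiple of the tight constraint until a further matching becomes optimal, then
cutting off at zero, leaves fewer non-optimal edge sets. Induction bounds the new weight, and adding
the constraint back bounds the old one (`sum_mul_le_of_nonneg`). -/

/-- Two involutions `m` and `n` generate a dihedral group; the orbit of a fixed point of `n`
contains at most one fixed point of `m`. -/
theorem exists_invariant_set_of_involutive {V : Type*} {m n : V → V}
    (hm : Function.Involutive m) (hn : Function.Involutive n) {t : V} (ht : n t = t) :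
    ∃ S : Set V, t ∈ S ∧ (∀ a ∈ S, m a ∈ S) ∧ (∀ a ∈ S, n a ∈ S) ∧
      ∀ a ∈ S, ∀ b ∈ S, m a = a → m b = b → a = b := by
  set p : Equiv.Perm V := hm.toPerm
  set q : Equiv.Perm V := hn.toPerm
  have hpp : p * p = 1 := Equiv.ext hm
  have hqq : q * q = 1 := Equiv.ext hn
  have hp : p⁻¹ = p := inv_eq_of_mul_eq_one_left hpp
  have hq : q⁻¹ = q := inv_eq_of_mul_eq_one_left hqq
  set g : Equiv.Perm V := q * p with hg
  have hconj : ∀ k : ℤ, q * g ^ k = g ^ (-k) * q := by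
    intro k
    have h : SemiconjBy q g g⁻¹ := by
      rw [SemiconjBy, hg, mul_inv_rev, hp, hq, ← mul_assoc, hqq, mul_assoc, hqq, one_mul, mul_one]
    simpa [SemiconjBy] using h.zpow_right k
  have hqt : q t = t := ht
  have hqk : ∀ k : ℤ, n ((g ^ k) t) = (g ^ (-k)) t := fun k ↦ by
    have h := Equiv.Perm.congr_fun (hconj k) t
    rw [Equiv.Perm.mul_apply, Equiv.Perm.mul_apply, hqt] at h
    exact h
  have hmk : ∀ k : ℤ, m ((g ^ k) t) = (g ^ (-k - 1)) t := fun k ↦ by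
    have h1 : p * g ^ k = q * g ^ (k + 1) := by
      rw [add_comm, zpow_add, zpow_one, ← mul_assoc, hg, ← mul_assoc, hqq, one_mul]
    have h2 : m ((g ^ k) t) = n ((g ^ (k + 1)) t) := Equiv.Perm.congr_fun h1 t
    rw [h2, hqk]
    congr 2
    ring
  -- Since `q` fixes `t`, the powers of the rotation `g = q * p` already sweep out the whole
  -- dihedral orbit.
  refine ⟨Set.range fun k : ℤ ↦ (g ^ k) t, ⟨0, rfl⟩, ?_, ?_, ?_⟩
  · rintro _ ⟨k, rfl⟩
    exact ⟨-k - 1, (hmk k).symm⟩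
  · rintro _ ⟨k, rfl⟩
    exact ⟨-k, (hqk k).symm⟩
  · rintro _ ⟨k, rfl⟩ _ ⟨l, rfl⟩ hk hl
    have shift : ∀ i j : ℤ, (g ^ i) t = (g ^ j) t ↔ g ^ (i - j) ∈ MulAction.stabilizer _ t := by
      intro i j
      rw [MulAction.mem_stabilizer_iff, Equiv.Perm.smul_def, sub_eq_neg_add, zpow_add,
        Equiv.Perm.mul_apply, zpow_neg, Equiv.Perm.inv_eq_iff_eq, eq_comm]
    simp only [hmk] at hk hl ⊢
    rw [shift] at hk hl ⊢
    have h1 := mul_mem (inv_mem hk) hl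
    -- Both `2k+1` and `2(k-l)` are periods of `t`. As `2k+1` is odd, so is `k-l = (2k+1)(k-l) -
    -- k·2(k-l)`.
    have : g ^ (k - l) = (g ^ (-k - 1 - k)) ^ (-(k - l)) * ((g ^ (-k - 1 - k))⁻¹ *
        g ^ (-l - 1 - l)) ^ (-k) := by
      simp only [← zpow_neg, ← zpow_add, ← zpow_mul]
      congr 1
      ring
    rw [this]
    exact mul_mem (zpow_mem hk _) (zpow_mem h1 _)

/-! ### Matchings and alternating exchange -/

section Edmonds

variable {V : Type*} {H : Digraph V}

theorem IsMatching.mono {M N : Set (Edge H)} (hM : IsMatching H M) (h : N ⊆ M) :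
    IsMatching H N :=
  fun e he e' he' ↦ hM e (h he) e' (h he')

theorem IsMatching.eq_of_incident {M : Set (Edge H)} (hM : IsMatching H M) {e e' : Edge H}
    (he : e ∈ M) (he' : e' ∈ M) {v : V} (h : e.Incident v) (h' : e'.Incident v) : e = e' := by
  by_contra hne
  exact hM e he e' he' hne v ⟨h, h'⟩

/-- The matching `M` leaves the vertex `v` uncovered. -/
def Misses (M : Set (Edge H)) (v : V) : Prop := ∀ e ∈ M, ¬ e.Incident v

/-- A matching induces an involution of the vertices which swaps the ends of its edges and fixes
the uncovered vertices. -/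
theorem IsMatching.exists_involutive {M : Set (Edge H)} (hM : IsMatching H M) :
    ∃ m : V → V, Function.Involutive m ∧ (∀ v, Misses M v → m v = v) ∧
      ∀ e ∈ M, m e.1.1 = e.1.2 ∧ m e.1.2 = e.1.1 := by
  classical
  have key : ∀ v, ∃ u, (Misses M v → u = v) ∧
      ∀ e ∈ M, (e.1.1 = v → u = e.1.2) ∧ (e.1.2 = v → u = e.1.1) := by
    intro v
    by_cases h : Misses M v
    · exact ⟨v, fun _ ↦ rfl, fun e he ↦ ⟨fun hv ↦ (h e he (.inl hv)).elim,
        fun hv ↦ (h e he (.inr hv)).elim⟩⟩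
    · have h' := h
      simp only [Misses, not_forall, not_not] at h'
      obtain ⟨e, he, hev⟩ := h'
      rcases hev with hv | hv
      · refine ⟨e.1.2, fun h' ↦ (h h').elim, fun f hf ↦ ⟨fun hf1 ↦ ?_, fun hf2 ↦ ?_⟩⟩
        · rw [hM.eq_of_incident he hf (.inl hv) (.inl hf1)]
        · have := hM.eq_of_incident he hf (.inl hv) (.inr hf2)
          subst this
          rw [hv, hf2]
      · refine ⟨e.1.1, fun h' ↦ (h h').elim, fun f hf ↦ ⟨fun hf1 ↦ ?_, fun hf2 ↦ ?_⟩⟩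
        · have := hM.eq_of_incident he hf (.inr hv) (.inl hf1)
          subst this
          rw [hv, hf1]
        · rw [hM.eq_of_incident he hf (.inr hv) (.inr hf2)]
  choose m hm1 hm2 using key
  refine ⟨m, fun v ↦ ?_, hm1, fun e he ↦ ⟨(hm2 _ e he).1 rfl, (hm2 _ e he).2 rfl⟩⟩
  by_cases h : Misses M v
  · rw [hm1 v h, hm1 v h]
  · simp only [Misses, not_forall, not_not] at h
    obtain ⟨e, he, rfl | rfl⟩ := h
    · rw [(hm2 _ e he).1 rfl, (hm2 _ e he).2 rfl]
    · rw [(hm2 _ e he).2 rfl, (hm2 _ e he).1 rfl]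

/-- `M` is a matching of maximum weight. -/
def IsMaxMatching (w : Edge H → ℝ) (M : Finset (Edge H)) : Prop :=
  IsMatching H (M : Set (Edge H)) ∧
    ∀ N : Finset (Edge H), IsMatching H (N : Set (Edge H)) → ∑ e ∈ N, w e ≤ ∑ e ∈ M, w e

/-- If `M` and `N` have their edges inside or outside of `S`, then `M` may be replaced by `N`
inside `S`. -/
theorem IsMatching.piecewise {M N : Set (Edge H)} {S : Set V} (hM : IsMatching H M)
    (hN : IsMatching H N) (hMS : ∀ e ∈ M, e.1.1 ∈ S ↔ e.1.2 ∈ S)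
    (hNS : ∀ e ∈ N, e.1.1 ∈ S ↔ e.1.2 ∈ S) :
    IsMatching H {e | e ∈ M ∧ e.1.1 ∉ S ∨ e ∈ N ∧ e.1.1 ∈ S} := by
  have side : ∀ e : Edge H, (e.1.1 ∈ S ↔ e.1.2 ∈ S) → ∀ v, e.Incident v → (e.1.1 ∈ S ↔ v ∈ S) := by
    rintro e he v (rfl | rfl)
    exacts [Iff.rfl, he]
  rintro e (⟨he, hS⟩ | ⟨he, hS⟩) e' (⟨he', hS'⟩ | ⟨he', hS'⟩) hne v ⟨hv, hv'⟩
  · exact hM e he e' he' hne v ⟨hv, hv'⟩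
  · exact hS ((side e (hMS e he) v hv).2 ((side e' (hNS e' he') v hv').1 hS'))
  · exact hS' ((side e' (hMS e' he') v hv').2 ((side e (hNS e he) v hv).1 hS))
  · exact hN e he e' he' hne v ⟨hv, hv'⟩

/-- Two maximum weight matchings can be exchanged along an alternating path: if `N` misses `t`,
and `M` misses `u` and `v`, then a maximum weight matching misses `t` and one of `u` and `v`. -/
theorem IsMaxMatching.exchange {w : Edge H → ℝ} {M N : Finset (Edge H)} (hM : IsMaxMatching w M)
    (hN : IsMaxMatching w N) {t u v : V} (ht : Misses (N : Set (Edge H)) t)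
    (hu : Misses (M : Set (Edge H)) u) (hv : Misses (M : Set (Edge H)) v) (huv : u ≠ v) :
    ∃ M' : Finset (Edge H), IsMaxMatching w M' ∧ Misses (M' : Set (Edge H)) t ∧
      (Misses (M' : Set (Edge H)) u ∨ Misses (M' : Set (Edge H)) v) := by
  classical
  obtain ⟨m, hm, hmM, hme⟩ := hM.1.exists_involutive
  obtain ⟨n, hn, hnN, hne⟩ := hN.1.exists_involutive
  obtain ⟨S, htS, hSm, hSn, hS⟩ := exists_invariant_set_of_involutive hm hn (hnN t ht)
  have hMS : ∀ e ∈ (M : Set (Edge H)), e.1.1 ∈ S ↔ e.1.2 ∈ S := fun e he ↦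
    ⟨fun h ↦ (hme e he).1 ▸ hSm _ h, fun h ↦ (hme e he).2 ▸ hSm _ h⟩
  have hNS : ∀ e ∈ (N : Set (Edge H)), e.1.1 ∈ S ↔ e.1.2 ∈ S := fun e he ↦
    ⟨fun h ↦ (hne e he).1 ▸ hSn _ h, fun h ↦ (hne e he).2 ▸ hSn _ h⟩
  set M' := {e ∈ M | e.1.1 ∉ S} ∪ {e ∈ N | e.1.1 ∈ S} with hM'
  -- The complementary swap: `M'` and `N'` together weigh as much as `M` and `N`, so neither can
  -- fall below the maximum.
  set N' := {e ∈ N | e.1.1 ∉ S} ∪ {e ∈ M | e.1.1 ∈ S} with hN'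
  have hM'm : IsMatching H (M' : Set (Edge H)) :=
    (hM.1.piecewise hN.1 hMS hNS).mono fun e he ↦ by simpa [hM'] using he
  have hN'm : IsMatching H (N' : Set (Edge H)) :=
    (hN.1.piecewise hM.1 hNS hMS).mono fun e he ↦ by simpa [hN'] using he
  have hsum : ∑ e ∈ M', w e + ∑ e ∈ N', w e = ∑ e ∈ M, w e + ∑ e ∈ N, w e := by
    rw [hM', hN', Finset.sum_union, Finset.sum_union,
      ← Finset.sum_filter_add_sum_filter_not M (fun e ↦ e.1.1 ∈ S),
      ← Finset.sum_filter_add_sum_filter_not N (fun e ↦ e.1.1 ∈ S)]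
    · ring
    all_goals
      rw [Finset.disjoint_left]
      intro e he he'
      exact (Finset.mem_filter.1 he).2 (Finset.mem_filter.1 he').2
  have hside : ∀ x, x ∉ S → Misses (M : Set (Edge H)) x → Misses (M' : Set (Edge H)) x := by
    intro x hx hMx e he hex
    simp only [hM', Finset.coe_union, Finset.coe_filter, Set.mem_union, Set.mem_ofPred_eq] at he
    rcases he with he | he
    · exact hMx e he.1 hex
    · rcases hex with rfl | rfl
      · exact hx he.2
      · exact hx ((hNS e he.1).1 he.2)
  refine ⟨M', ⟨hM'm, fun L hL ↦ ?_⟩, ?_, ?_⟩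
  · have h1 := hN.2 N' hN'm
    have h2 := hM.2 L hL
    linarith
  · intro e he het
    simp only [hM', Finset.coe_union, Finset.coe_filter, Set.mem_union, Set.mem_ofPred_eq] at he
    rcases he with he | he
    · rcases het with rfl | rfl
      · exact he.2 htS
      · exact he.2 ((hMS e he.1).2 htS)
    · exact ht e he.1 het
  -- `m` fixes `u` and `v`, so at most one of them lies in `S`; outside `S` nothing has changed.
  · by_cases huS : u ∈ S
    · exact .inr (hside v (fun hvS ↦ huv (hS u huS v hvS (hmM u hu) (hmM v hv))) hv)
    · exact .inl (hside u huS hu)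

/-! ### Components of the positive-weight edges -/

/-- Two vertices are ends of one edge of positive weight. -/
def PosAdj (w : Edge H → ℝ) (a b : V) : Prop :=
  ∃ e : Edge H, 0 < w e ∧ e.Incident a ∧ e.Incident b

theorem PosAdj.symm {w : Edge H → ℝ} {a b : V} (h : PosAdj w a b) : PosAdj w b a := by
  obtain ⟨e, he, ha, hb⟩ := h
  exact ⟨e, he, hb, ha⟩

/-- Otherwise the positive edge could be added to the matching, raising its weight. -/
theorem IsMaxMatching.not_misses_of_posAdj {w : Edge H → ℝ} {M : Finset (Edge H)}
    (hM : IsMaxMatching w M) {a b : V} (h : PosAdj w a b) (hab : a ≠ b)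
    (ha : Misses (M : Set (Edge H)) a) : ¬ Misses (M : Set (Edge H)) b := by
  classical
  intro hb
  obtain ⟨e, he, hea, heb⟩ := h
  have hinc : ∀ x, e.Incident x → x = a ∨ x = b := by
    rcases hea with rfl | rfl <;> rcases heb with rfl | rfl <;> rintro x (rfl | rfl) <;> simp_all
  have hmiss : ∀ x, e.Incident x → Misses (M : Set (Edge H)) x := by
    intro x hx
    rcases hinc x hx with rfl | rfl <;> assumption
  have heM : e ∉ M := fun h ↦ ha e h hea
  have hmat : IsMatching H ((insert e M : Finset (Edge H)) : Set (Edge H)) := by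
    intro f hf f' hf' hne v ⟨hv, hv'⟩
    simp only [Finset.coe_insert, Set.mem_insert_iff] at hf hf'
    rcases hf with rfl | hf <;> rcases hf' with rfl | hf'
    · exact hne rfl
    · exact hmiss v hv f' hf' hv'
    · exact hmiss v hv' f hf hv
    · exact hM.1 f hf f' hf' hne v ⟨hv, hv'⟩
  have := hM.2 _ hmat
  rw [Finset.sum_insert heM] at this
  linarith

/-- If every vertex is missed by some maximum weight matching, then no maximum weight matching
misses two vertices which are joined by edges of positive weight. -/
theorem IsMaxMatching.not_misses_of_reflTransGen {w : Edge H → ℝ}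
    (hw : ∀ v, ∃ M : Finset (Edge H), IsMaxMatching w M ∧ Misses (M : Set (Edge H)) v) {u v : V}
    (h : Relation.ReflTransGen (PosAdj w) u v) :
    u ≠ v → ∀ M : Finset (Edge H), IsMaxMatching w M → Misses (M : Set (Edge H)) u →
      ¬ Misses (M : Set (Edge H)) v := by
  induction h using Relation.ReflTransGen.head_induction_on with
  | refl => exact fun h ↦ (h rfl).elim
  | @head u t hut htv ih =>
    intro huv M hM hMu hMv
    by_cases hut' : u = t
    · subst hut'
      exact ih huv M hM hMu hMv
    by_cases htv' : t = v
    · subst htv'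
      exact hM.not_misses_of_posAdj hut huv hMu hMv
    -- Exchanging with a matching that misses `t` gives one missing `t` and `u`, which are adjacent,
    -- or `t` and `v`, which are closer along the path.
    obtain ⟨N, hN, hNt⟩ := hw t
    obtain ⟨M', hM', ht, hu | hv⟩ := hM.exchange hN hNt hMu hMv huv
    · exact hM'.not_misses_of_posAdj hut hut' hu ht
    · exact ih htv' M' hM' ht hv

/-! ### Counting bounds and tight constraints -/

open Classical in
/-- The ends of the edges of a matching are distinct. -/
theorem IsMatching.two_mul_card (hH : ∀ v, ¬ H.Adj v v) {F : Finset (Edge H)}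
    (hF : IsMatching H (F : Set (Edge H))) :
    2 * #F = #(F.biUnion fun e ↦ {e.1.1, e.1.2}) := by
  rw [Finset.card_biUnion, Finset.sum_congr rfl (g := fun _ ↦ 2), Finset.sum_const, smul_eq_mul,
    mul_comm]
  · intro e _
    refine Finset.card_pair fun h ↦ hH e.1.1 ?_
    have := e.2
    rwa [← h] at this
  · intro e he e' he' hne
    refine Finset.disjoint_left.2 fun v hv hv' ↦ ?_
    refine hF e he e' he' hne v ⟨?_, ?_⟩
    · simpa [Edge.Incident, eq_comm] using hv
    · simpa [Edge.Incident, eq_comm] using hv'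

open Classical in
theorem IsMatching.card_filter_le (hH : ∀ v, ¬ H.Adj v v) {M : Finset (Edge H)}
    (hM : IsMatching H (M : Set (Edge H))) (U : Finset V) :
    #{e ∈ M | e.1.1 ∈ U ∧ e.1.2 ∈ U} ≤ #U / 2 := by
  have h := (hM.mono (N := (({e ∈ M | e.1.1 ∈ U ∧ e.1.2 ∈ U} : Finset (Edge H)) : Set (Edge H)))
    (Finset.coe_subset.2 (Finset.filter_subset _ _))).two_mul_card hH
  have h2 : #(({e ∈ M | e.1.1 ∈ U ∧ e.1.2 ∈ U} : Finset (Edge H)).biUnion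
      fun e ↦ {e.1.1, e.1.2}) ≤ #U := by
    refine Finset.card_le_card (Finset.biUnion_subset.2 fun e he ↦ ?_)
    simpa [Finset.insert_subset_iff] using (Finset.mem_filter.1 he).2
  lia

theorem IsMatching.card_filter_incident_le {M : Finset (Edge H)}
    (hM : IsMatching H (M : Set (Edge H))) (v : V) [DecidablePred fun e : Edge H ↦ e.Incident v] :
    #{e ∈ M | e.Incident v} ≤ 1 := by
  refine Finset.card_le_one.2 fun e he e' he' ↦ ?_
  simp only [Finset.mem_filter] at he he'
  exact hM.eq_of_incident he.1 he'.1 he.2 he'.2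

-- Dropping nonpositive edges cannot lower the weight; the edges left never leave a component of the
-- positive ones.
open Classical in
theorem IsMaxMatching.filter_pos {w : Edge H → ℝ} {M : Finset (Edge H)}
    (hM : IsMaxMatching w M) : IsMaxMatching w {e ∈ M | 0 < w e} := by
  refine ⟨hM.1.mono (Finset.coe_subset.2 (Finset.filter_subset _ _)), fun N hN ↦ (hM.2 N hN).trans ?_⟩
  rw [← Finset.sum_filter_add_sum_filter_not M (fun e ↦ 0 < w e)]
  have : ∑ e ∈ M with ¬ 0 < w e, w e ≤ 0 :=
    Finset.sum_nonpos fun e he ↦ not_lt.1 (Finset.mem_filter.1 he).2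
  linarith

open Classical in
/-- Some degree or odd-set constraint is tight for all maximum weight matchings. -/
theorem exists_tight_constraint [Fintype V] (hH : ∀ v, ¬ H.Adj v v) {w : Edge H → ℝ}
    {e₀ : Edge H} (h₀ : 0 < w e₀) :
    (∃ v, ∀ M : Finset (Edge H), IsMaxMatching w M → #{e ∈ M | e.Incident v} = 1) ∨
    ∃ U : Finset V, Odd #U ∧ 2 ≤ #U ∧
      ∀ M : Finset (Edge H), IsMaxMatching w M →
        #{e ∈ M | e.1.1 ∈ U ∧ e.1.2 ∈ U} = #U / 2 := by
  by_cases hw : ∀ v, ∃ M : Finset (Edge H), IsMaxMatching w M ∧ Misses (M : Set (Edge H)) v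
  swap
  · push Not at hw
    obtain ⟨v, hv⟩ := hw
    refine .inl ⟨v, fun M hM ↦ le_antisymm (hM.1.card_filter_incident_le v) ?_⟩
    have := hv M hM
    simp only [Misses, not_forall, not_not] at this
    obtain ⟨e, he, hev⟩ := this
    exact Finset.card_pos.2 ⟨e, Finset.mem_filter.2 ⟨he, hev⟩⟩
  right
  have hsymm : Std.Symm (PosAdj w) := ⟨fun _ _ h ↦ h.symm⟩
  set U : Finset V := {v | Relation.ReflTransGen (PosAdj w) e₀.1.1 v} with hU
  have memU : ∀ v, v ∈ U ↔ Relation.ReflTransGen (PosAdj w) e₀.1.1 v := by simp [hU]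
  have hconn : ∀ a ∈ U, ∀ b ∈ U, Relation.ReflTransGen (PosAdj w) a b := fun a ha b hb ↦
    (symm_of (Relation.ReflTransGen (PosAdj w)) ((memU a).1 ha)).trans ((memU b).1 hb)
  have hclosed : ∀ e : Edge H, 0 < w e → ∀ v ∈ U, e.Incident v → e.1.1 ∈ U ∧ e.1.2 ∈ U := by
    intro e he v hv hev
    exact ⟨(memU _).2 (((memU v).1 hv).tail ⟨e, he, hev, .inl rfl⟩),
      (memU _).2 (((memU v).1 hv).tail ⟨e, he, hev, .inr rfl⟩)⟩
  have hmem₁ : e₀.1.1 ∈ U := (memU _).2 .refl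
  have hmem₂ : e₀.1.2 ∈ U := (hclosed e₀ h₀ _ hmem₁ (.inl rfl)).2
  have hne : e₀.1.1 ≠ e₀.1.2 := by
    intro h
    have := e₀.2
    rw [← h] at this
    exact hH _ this
  have hcard : 2 ≤ #U := by
    rw [← Finset.card_pair hne]
    exact Finset.card_le_card (by simp [Finset.insert_subset_iff, hmem₁, hmem₂])
  let F (M : Finset (Edge H)) : Finset (Edge H) := {e ∈ M | e.1.1 ∈ U ∧ e.1.2 ∈ U}
  let cov (M : Finset (Edge H)) : Finset V := (F M).biUnion fun e ↦ {e.1.1, e.1.2}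
  have hcov : ∀ M : Finset (Edge H), ∀ v, v ∈ cov M ↔ ∃ e ∈ F M, e.Incident v := by
    simp [cov, Edge.Incident, eq_comm]
  have hcov_sub : ∀ M, cov M ⊆ U := by
    intro M
    refine Finset.biUnion_subset.2 fun e he ↦ ?_
    simpa [Finset.insert_subset_iff] using (Finset.mem_filter.1 he).2
  have hF : ∀ M, IsMaxMatching w M → 2 * #(F M) = #(cov M) := fun M hM ↦
    (hM.1.mono (Finset.coe_subset.2 (Finset.filter_subset _ _))).two_mul_card hH
  have hlow : ∀ M, IsMaxMatching w M → #U ≤ 2 * #(F M) + 1 := by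
    intro M hM
    have hM₀ := hM.filter_pos
    set M₀ : Finset (Edge H) := {e ∈ M | 0 < w e} with hM₀'
    have hone : #(U \ cov M₀) ≤ 1 := by
      refine Finset.card_le_one.2 fun a ha b hb ↦ ?_
      have hmiss : ∀ x ∈ U \ cov M₀, Misses (M₀ : Set (Edge H)) x := by
        intro x hx e he hex
        rw [Finset.mem_sdiff] at hx
        exact hx.2 ((hcov _ _).2 ⟨e, Finset.mem_filter.2 ⟨he,
          hclosed e (Finset.mem_filter.1 he).2 x hx.1 hex⟩, hex⟩)
      by_contra hab
      exact IsMaxMatching.not_misses_of_reflTransGen hw (hconn a (Finset.mem_sdiff.1 ha).1 b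
        (Finset.mem_sdiff.1 hb).1) hab M₀ hM₀ (hmiss a ha) (hmiss b hb)
    have h1 := Finset.card_sdiff_add_card_eq_card (hcov_sub M₀)
    have h2 := hF M₀ hM₀
    have h3 : #(F M₀) ≤ #(F M) :=
      Finset.card_le_card (Finset.filter_subset_filter _ (Finset.filter_subset _ _))
    lia
  have hodd : Odd #U := by
    -- A maximum matching missing a vertex of `U` covers, by edges inside `U`, an even number of
    -- vertices that is both at least and at most `#U - 1`.
    obtain ⟨M, hM, hmiss⟩ := hw e₀.1.1
    have h1 := hlow M hM
    have h2 := hF M hM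
    have h3 : #(cov M) ≤ #(U.erase e₀.1.1) := by
      refine Finset.card_le_card fun v hv ↦ Finset.mem_erase.2 ⟨?_, hcov_sub M hv⟩
      rintro rfl
      obtain ⟨e, he, hev⟩ := (hcov _ _).1 hv
      exact hmiss e (Finset.mem_filter.1 he).1 hev
    rw [Finset.card_erase_of_mem hmem₁] at h3
    exact ⟨#(F M), by lia⟩
  refine ⟨U, hodd, hcard, fun M hM ↦ le_antisymm (hM.1.card_filter_le hH U) ?_⟩
  have := hlow M hM
  change #U / 2 ≤ #(F M)
  lia

open Classical in
/-- Some linear inequality which is valid for the matchings and for the matching polytope is tight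
for all maximum weight matchings. -/
theorem exists_tight_inequality [Fintype V] (hH : ∀ v, ¬ H.Adj v v) {w : Edge H → ℝ}
    {e₀ : Edge H} (h₀ : 0 < w e₀) :
    ∃ (a : Edge H → ℝ) (b : ℝ), 0 < b ∧
      (∀ M : Finset (Edge H), IsMatching H (M : Set (Edge H)) → ∑ e ∈ M, a e ≤ b) ∧
      (∀ M : Finset (Edge H), IsMaxMatching w M → ∑ e ∈ M, a e = b) ∧
      ∀ x ∈ matchingPolytope H, ∑ e, a e * x e ≤ b := by
  rcases exists_tight_constraint hH h₀ with ⟨v, hv⟩ | ⟨U, hodd, hcard, hU⟩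
  · refine ⟨fun e ↦ if e.Incident v then 1 else 0, 1, one_pos, fun M hM ↦ ?_, fun M hM ↦ ?_,
      fun x hx ↦ ?_⟩
    · rw [Finset.sum_boole]
      exact_mod_cast hM.card_filter_incident_le v
    · rw [Finset.sum_boole]
      exact_mod_cast hv M hM
    · have := hx.2.1 v
      rw [Finset.sum_filter] at this
      simpa [ite_mul] using this
  · refine ⟨fun e ↦ if e.1.1 ∈ U ∧ e.1.2 ∈ U then 1 else 0, ((#U / 2 : ℕ) : ℝ), ?_,
      fun M hM ↦ ?_, fun M hM ↦ ?_, fun x hx ↦ ?_⟩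
    · exact_mod_cast Nat.div_pos hcard two_pos
    · rw [Finset.sum_boole]
      exact_mod_cast hM.card_filter_le hH U
    · rw [Finset.sum_boole]
      exact_mod_cast hU M hM
    · have := hx.2.2 U hodd
      rw [Finset.sum_filter] at this
      simpa only [ite_mul, one_mul, zero_mul] using this

/-! ### Weight reduction -/

open Classical in
/-- A maximum weight matching remains one when the negative weights are raised to zero, and its
weight does not change. -/
theorem IsMaxMatching.posPart {w : Edge H → ℝ} {M : Finset (Edge H)} (hM : IsMaxMatching w M) :
    IsMaxMatching (fun e ↦ max (w e) 0) M ∧ ∑ e ∈ M, max (w e) 0 = ∑ e ∈ M, w e := by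
  have key : ∀ N : Finset (Edge H), IsMatching H (N : Set (Edge H)) →
      ∑ e ∈ N, max (w e) 0 ≤ ∑ e ∈ M, w e := by
    intro N hN
    refine le_trans (le_of_eq ?_) (hM.2 {e ∈ N | 0 < w e}
      (hN.mono (Finset.coe_subset.2 (Finset.filter_subset _ _))))
    rw [Finset.sum_filter]
    refine Finset.sum_congr rfl fun e _ ↦ ?_
    split_ifs with h
    · exact max_eq_left h.le
    · exact max_eq_right (not_lt.1 h)
  have hle : ∑ e ∈ M, w e ≤ ∑ e ∈ M, max (w e) 0 := Finset.sum_le_sum fun e _ ↦ le_max_left _ _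
  exact ⟨⟨hM.1, fun N hN ↦ (key N hN).trans hle⟩, le_antisymm (key M hM.1) hle⟩

open Classical in
theorem exists_isMaxMatching [Fintype V] (w : Edge H → ℝ) :
    ∃ M : Finset (Edge H), IsMaxMatching w M := by
  obtain ⟨M, hM, hmax⟩ := Finset.exists_max_image
    (Finset.univ.filter fun M : Finset (Edge H) ↦ IsMatching H (M : Set (Edge H)))
    (fun M ↦ ∑ e ∈ M, w e) ⟨∅, by simp [IsMatching]⟩
  exact ⟨M, (Finset.mem_filter.1 hM).2, fun N hN ↦ hmax N (by simpa using hN)⟩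

open Classical in
/-- Lowering the weights along an inequality which is tight for the maximum weight matchings, until
another matching attains the maximum weight. -/
theorem exists_isMaxMatching_sub_smul [Fintype V] {w a : Edge H → ℝ} {b : ℝ} (hb : 0 < b)
    (ha : ∀ M : Finset (Edge H), IsMatching H (M : Set (Edge H)) → ∑ e ∈ M, a e ≤ b)
    (hmax : ∀ M : Finset (Edge H), IsMaxMatching w M → ∑ e ∈ M, a e = b) :
    ∃ ε : ℝ, 0 ≤ ε ∧ (∀ M, IsMaxMatching w M → IsMaxMatching (fun e ↦ w e - ε * a e) M) ∧
      ∃ M, ¬ IsMaxMatching w M ∧ IsMaxMatching (fun e ↦ w e - ε * a e) M := by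
  obtain ⟨M₀, hM₀⟩ := exists_isMaxMatching w
  have hsum : ∀ (ε : ℝ) (M : Finset (Edge H)),
      ∑ e ∈ M, (w e - ε * a e) = ∑ e ∈ M, w e - ε * ∑ e ∈ M, a e := by
    intro ε M
    rw [Finset.sum_sub_distrib, Finset.mul_sum]
  -- The quotient is the `ε` at which `M` catches up with `M₀`; the smallest is the first such
  -- event. The empty matching is a candidate because `0 < b`.
  obtain ⟨M₁, hM₁, hmin⟩ := Finset.exists_min_image
    (Finset.univ.filter fun M : Finset (Edge H) ↦
      IsMatching H (M : Set (Edge H)) ∧ ∑ e ∈ M, a e < b)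
    (fun M ↦ (∑ e ∈ M₀, w e - ∑ e ∈ M, w e) / (b - ∑ e ∈ M, a e))
    ⟨∅, by simpa [IsMatching] using hb⟩
  simp only [Finset.mem_filter, Finset.mem_univ, true_and] at hM₁ hmin
  set ε := (∑ e ∈ M₀, w e - ∑ e ∈ M₁, w e) / (b - ∑ e ∈ M₁, a e) with hε
  have hε₀ : 0 ≤ ε := div_nonneg (sub_nonneg.2 (hM₀.2 _ hM₁.1)) (sub_nonneg.2 hM₁.2.le)
  have hbound : ∀ N : Finset (Edge H), IsMatching H (N : Set (Edge H)) →
      ∑ e ∈ N, (w e - ε * a e) ≤ ∑ e ∈ M₀, w e - ε * b := by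
    intro N hN
    rw [hsum]
    rcases (ha N hN).lt_or_eq with h | h
    · have := (le_div_iff₀ (sub_pos.2 h)).1 (hmin N ⟨hN, h⟩)
      linarith
    · rw [h]
      linarith [hM₀.2 N hN]
  refine ⟨ε, hε₀, fun M hM ↦ ⟨hM.1, fun N hN ↦ (hbound N hN).trans ?_⟩, M₁, fun h ↦ ?_,
    hM₁.1, fun N hN ↦ (hbound N hN).trans ?_⟩
  · rw [hsum, hmax M hM]
    linarith [hM.2 M₀ hM₀.1]
  · exact hM₁.2.ne (hmax M₁ h)
  · have : ε * (b - ∑ e ∈ M₁, a e) = ∑ e ∈ M₀, w e - ∑ e ∈ M₁, w e :=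
      div_mul_cancel₀ _ (sub_pos.2 hM₁.2).ne'
    rw [hsum]
    linarith

open Classical in
/-- A nonnegative weight function attains its maximum over the matching polytope at a matching. -/
theorem sum_mul_le_of_nonneg [Fintype V] (hH : ∀ v, ¬ H.Adj v v) {x : Edge H → ℝ}
    (hx : x ∈ matchingPolytope H) (w : Edge H → ℝ) (hw : ∀ e, 0 ≤ w e) {M : Finset (Edge H)}
    (hM : IsMaxMatching w M) : ∑ e, w e * x e ≤ ∑ e ∈ M, w e := by
  -- Optimal matchings stay optimal after the reduction and `M₁` joins them, so this count drops.
  induction hk : #{M : Finset (Edge H) | ¬ IsMaxMatching w M} using Nat.strong_induction_on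
    generalizing w M with
  | _ k ih =>
    subst hk
    by_cases h₀ : ∃ e₀, 0 < w e₀
    swap
    · push Not at h₀
      calc ∑ e, w e * x e ≤ 0 :=
            Finset.sum_nonpos fun e _ ↦ mul_nonpos_of_nonpos_of_nonneg (h₀ e) (hx.1 e)
        _ ≤ ∑ e ∈ M, w e := Finset.sum_nonneg fun e _ ↦ hw e
    obtain ⟨e₀, h₀⟩ := h₀
    obtain ⟨a, b, hb, hab, hmax, hxa⟩ := exists_tight_inequality hH h₀
    obtain ⟨ε, hε, hmono, M₁, hM₁, hM₁'⟩ := exists_isMaxMatching_sub_smul hb hab hmax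
    have hlt : #{M : Finset (Edge H) | ¬ IsMaxMatching (fun e ↦ max (w e - ε * a e) 0) M} <
        #{M : Finset (Edge H) | ¬ IsMaxMatching w M} := by
      refine Finset.card_lt_card (Finset.ssubset_iff_of_subset ?_ |>.2 ⟨M₁, ?_, ?_⟩)
      · intro N hN
        simp only [Finset.mem_filter, Finset.mem_univ, true_and] at hN ⊢
        exact fun h ↦ hN (hmono N h).posPart.1
      · simpa using hM₁
      · simpa using hM₁'.posPart.1
    have hpos := (hmono M hM).posPart
    have h1 := ih _ hlt (fun e ↦ max (w e - ε * a e) 0) (fun e ↦ le_max_right _ _) hpos.1 rfl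
    have h2 : ∑ e, (w e - ε * a e) * x e ≤ ∑ e, max (w e - ε * a e) 0 * x e :=
      Finset.sum_le_sum fun e _ ↦ mul_le_mul_of_nonneg_right (le_max_left _ _) (hx.1 e)
    have h3 : ∑ e, (w e - ε * a e) * x e = ∑ e, w e * x e - ε * ∑ e, a e * x e := by
      rw [Finset.mul_sum, ← Finset.sum_sub_distrib]
      exact Finset.sum_congr rfl fun e _ ↦ by ring
    have h4 : ∑ e ∈ M, (w e - ε * a e) = ∑ e ∈ M, w e - ε * b := by
      rw [← hmax M hM, Finset.mul_sum, Finset.sum_sub_distrib]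
    have h5 := mul_le_mul_of_nonneg_left (hxa x hx) hε
    linarith [hpos.2]

-- Since `x ≥ 0`, raising negative weights to zero can only increase the left side, and the optimum
-- is unchanged.
open Classical in
theorem sum_mul_le [Fintype V] (hH : ∀ v, ¬ H.Adj v v) {x : Edge H → ℝ}
    (hx : x ∈ matchingPolytope H) {w : Edge H → ℝ} {M : Finset (Edge H)}
    (hM : IsMaxMatching w M) : ∑ e, w e * x e ≤ ∑ e ∈ M, w e := by
  rw [← hM.posPart.2]
  exact (Finset.sum_le_sum fun e _ ↦ mul_le_mul_of_nonneg_right (le_max_left _ _) (hx.1 e)).trans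
    (sum_mul_le_of_nonneg hH hx _ (fun e ↦ le_max_right _ _) hM.posPart.1)

/-! ### The matching polytope theorem -/

theorem convex_matchingPolytope [Fintype V] : Convex ℝ (matchingPolytope H) := by
  intro x hx y hy s t hs ht hst
  have hsum : ∀ F : Finset (Edge H), ∀ c : ℝ, ∑ e ∈ F, x e ≤ c → ∑ e ∈ F, y e ≤ c →
      ∑ e ∈ F, (s • x + t • y) e ≤ c := by
    intro F c hxc hyc
    simp only [Pi.add_apply, Pi.smul_apply, smul_eq_mul, Finset.sum_add_distrib, ← Finset.mul_sum]
    calc _ ≤ s * c + t * c := by gcongr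
      _ = c := by rw [← add_mul, hst, one_mul]
  exact ⟨fun e ↦ add_nonneg (mul_nonneg hs (hx.1 e)) (mul_nonneg ht (hy.1 e)),
    fun v ↦ hsum _ _ (hx.2.1 v) (hy.2.1 v), fun U hU ↦ hsum _ _ (hx.2.2 U hU) (hy.2.2 U hU)⟩

theorem matchings_subset_matchingPolytope [Fintype V] (hH : ∀ v, ¬ H.Adj v v) :
    matchings H ⊆ matchingPolytope H := by
  classical
  rintro _ ⟨M, hM, rfl⟩
  have hM' : IsMatching H (M.toFinset : Set (Edge H)) := by simpa using hM
  have hsum : ∀ F : Finset (Edge H), ∑ e ∈ F, M.indicator (1 : Edge H → ℝ) e =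
      #{e ∈ F | e ∈ M} := by
    intro F
    simp [Set.indicator_apply]
  refine ⟨fun e ↦ Set.indicator_nonneg (fun _ _ ↦ zero_le_one) e, fun v ↦ ?_, fun U _ ↦ ?_⟩
  · rw [hsum]
    have := hM'.card_filter_incident_le v
    refine le_trans (Nat.cast_le.2 (Finset.card_le_card ?_)) (Nat.cast_le_one.2 this)
    intro e he
    simp_all
  · rw [hsum]
    refine Nat.cast_le.2 (le_trans (Finset.card_le_card ?_) (hM'.card_filter_le hH U))
    intro e he
    simp_all

/-- Edmonds' matching polytope theorem. -/
theorem convexHull_matchings [Fintype V] (hH : ∀ v, ¬ H.Adj v v) :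
    convexHull ℝ (matchings H) = matchingPolytope H := by
  classical
  refine (convexHull_min (matchings_subset_matchingPolytope hH)
    convex_matchingPolytope).antisymm fun x hx ↦ ?_
  by_contra hxM
  -- Finiteness makes the hull closed, so `x` can be strictly separated from it; the separating
  -- functional serves as a weight on the edges.
  have hfin : (matchings H).Finite :=
    (Set.finite_range fun M : Set (Edge H) ↦ M.indicator (1 : Edge H → ℝ)).subset
      (by rintro _ ⟨M, -, rfl⟩; exact ⟨M, rfl⟩)
  obtain ⟨f, c, hf, hfx⟩ := geometric_hahn_banach_closed_point (convex_convexHull ℝ (matchings H))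
    (hfin.isClosed_convexHull ℝ) hxM
  have hfsum : ∀ y : Edge H → ℝ, f y = ∑ e, f (Pi.single e 1) * y e := by
    intro y
    conv_lhs => rw [pi_eq_sum_univ' y, map_sum]
    refine Finset.sum_congr rfl fun e _ ↦ ?_
    rw [map_smul, smul_eq_mul, mul_comm]
  obtain ⟨M, hM⟩ := exists_isMaxMatching fun e ↦ f (Pi.single e 1)
  have h1 := sum_mul_le hH hx hM
  have h2 := hf _ (subset_convexHull ℝ _ ⟨(M : Set (Edge H)), hM.1, rfl⟩)
  rw [hfsum] at h2 hfx
  have h3 : ∑ e, f (Pi.single e 1) * (M : Set (Edge H)).indicator (1 : Edge H → ℝ) e =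
      ∑ e ∈ M, f (Pi.single e 1) := by
    simp [Set.indicator_apply]
  linarith

end Edmonds

/-! ### Schedules as matchings -/

namespace SectorizedNetwork

variable {N : ℕ} {K : Fin N → ℕ} (G : SectorizedNetwork N K)

/-- A sector's interference constraint is the matching condition at its vertex, and a 0-1 vector is
the indicator of the set where it equals 1. -/
theorem toAux_image_feasibleSchedules : G.toAux '' G.feasibleSchedules = matchings G.auxGraph := by
  have huses : ∀ (e : Edge G.auxGraph) (v : AuxVertex K),
      (G.edgeEquivLink e).Uses v.1 v.2 ↔ e.Incident v := fun e v ↦ Iff.rfl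
  ext x
  constructor
  · rintro ⟨X, ⟨h01, hX⟩, rfl⟩
    refine ⟨{e | X (G.edgeEquivLink e) = 1}, fun e he e' he' hne v ⟨hv, hv'⟩ ↦ ?_, ?_⟩
    · exact hne (G.edgeEquivLink.injective (hX v.1 v.2 ⟨he, (huses e v).2 hv⟩
        ⟨he', (huses e' v).2 hv'⟩))
    · classical
      ext e
      change X (G.edgeEquivLink e) = _
      rw [Set.indicator_apply]
      split_ifs with h
      · exact h
      · exact (h01 _).resolve_right h
  · rintro ⟨M, hM, rfl⟩
    refine ⟨G.toAux.symm (M.indicator 1), ⟨fun l ↦ ?_, fun n k l hl l' hl' ↦ ?_⟩,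
      G.toAux.apply_symm_apply _⟩
    · change M.indicator (1 : Edge G.auxGraph → ℝ) (G.edgeEquivLink.symm l) = 0 ∨
        M.indicator (1 : Edge G.auxGraph → ℝ) (G.edgeEquivLink.symm l) = 1
      exact Set.indicator_eq_zero_or_self M 1 _
    · have hmem : ∀ l : G.Link, G.toAux.symm (M.indicator 1) l = 1 →
          G.edgeEquivLink.symm l ∈ M := by
        intro l hl
        change M.indicator (1 : Edge G.auxGraph → ℝ) (G.edgeEquivLink.symm l) = 1 at hl
        exact Set.mem_of_indicator_ne_zero (hl.symm ▸ one_ne_zero)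
      exact G.edgeEquivLink.symm.injective (hM.eq_of_incident (hmem l hl.1) (hmem l' hl'.1)
        (v := ⟨n, k⟩) hl.2 hl'.2)

end SectorizedNetwork
end SectorNet

theorem lemma1 (N : ℕ) (K : Fin N → ℕ) (G : SectorNet.SectorizedNetwork N K) :
    G.toAux '' G.feasibleSchedules = SectorNet.matchings G.auxGraph ∧
    G.toAux '' convexHull ℝ G.feasibleSchedules =
      convexHull ℝ (SectorNet.matchings G.auxGraph) ∧
    convexHull ℝ (SectorNet.matchings G.auxGraph) =
      SectorNet.matchingPolytope G.auxGraph := by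
  -- The auxiliary graph has no loops because a link joins distinct nodes.
  refine ⟨G.toAux_image_feasibleSchedules, ?_, SectorNet.convexHull_matchings fun v h ↦ h.1 rfl⟩
  rw [← G.toAux_image_feasibleSchedules]
  exact G.toAux.toLinearMap.image_convexHull _
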